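/- **Proposition 6.1.** Let $\Omega\subset\mathbb R^2$ be a bounded open set with boundary $\Gamma$ (for instance a simply connected bounded Lipschitz domain). Write $(\cdot,\cdot)$ and $\|\cdot\|$ for the inner product and norm of $L_2(\Omega)$ and of $L_2(\Omega)^{2\times2}$, and let $\mathbb L_2^s(\Omega)\subset L_2(\Omega)^{2\times 2}$ be the subspace of symmetric tensors. All derivatives are weak. Let $H^2(\Omega)$ be the Sobolev space with norm $\|z\|_2^2=\|z\|^2+\|\nabla z\|^2+\|\nabla\nabla z\|^2$, and let $$H(\mathrm{div}\,\mathbf{div},\Omega)=\{M\in\mathbb L_2^s(\Omega):\ \mathrm{div}\,\mathbf{div}\,M\in L_2(\Omega)\},\qquad \|M\|_{\mathrm{dDiv}}^2=\|M\|^2+\|\mathrm{div}\,\mathbf{div}\,M\|^2,$$ where $\mathbf{div}$ is the row-wise divergence. For $M\in H(\mathrm{div}\,\mathbf{div},\Omega)$ and $z\in H^2(\Omega)$ put $$\langle \mathrm{tr}^{\mathrm{dDiv}}M,z\rangle=\langle \mathrm{tr}^{\mathrm{Ggrad}}z,M\rangle:=(\mathrm{div}\,\mathbf{div}\,M,z)-(M,\nabla\nabla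 z),$$ so that $\mathrm{tr}^{\mathrm{Ggrad}}:H^2(\Omega)\to H(\mathrm{div}\,\mathbf{div},\Omega)'$. Let $H^{3/2,1/2}(\Gamma)=\mathrm{tr}^{\mathrm{Ggrad}}(H^2(\Omega))$ with norm $\|g\|_{3/2,1/2,\Gamma}=\inf\{\|z\|_2:\ z\in H^2(\Omega),\ \mathrm{tr}^{\mathrm{Ggrad}}z=g\}$, and for $g=\mathrm{tr}^{\mathrm{Ggrad}}z$ write $\langle\mathrm{tr}^{\mathrm{dDiv}}M,g\rangle_\Gamma=\langle\mathrm{tr}^{\mathrm{dDiv}}M,z\rangle$ (independent of the choice of $z$). Let $\mathcal C:\mathbb L_2^s(\Omega)\to\mathbb L_2^s(\Omega)$ be a positive definite isomorphism, that is, a bounded linear bijection with bounded inverse for which there is $\alpha>0$ with $(\mathcal CN,N)\ge\alpha\|N\|^2$ for all $N\in\mathbb L_2^s(\Omega)$. Then there is a constant $c>0$, depending only on $\Omega$ and $\mathcal C$, such that for all $f\in L_2(\Omega)$ and $g\in H^{3/2,1/2}(\Gamma)$ the mixed Kirchhoff–Love problem: find $u\in L_2(\Omega)$ and $M\in H(\mathrm{div}\,\mathbf{div},\Omega)$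 with $$(\mathcal C^{-1}M,N)-(u,\mathrm{div}\,\mathbf{div}\,N)=-\langle\mathrm{tr}^{\mathrm{dDiv}}N,g\rangle_\Gamma\quad\forall N\in H(\mathrm{div}\,\mathbf{div},\Omega),$$ $$(\mathrm{div}\,\mathbf{div}\,M,v)=(f,v)\quad\forall v\in L_2(\Omega),$$ has exactly one solution $(u,M)$. This solution satisfies $u\in H^2(\Omega)$, $\mathrm{tr}^{\mathrm{Ggrad}}u=g$, $M=\mathcal C\nabla\nabla u$, and $$\|u\|_2+\|M\|_{\mathrm{dDiv}}\le c\,\bigl(\|f\|+\|g\|_{3/2,1/2,\Gamma}\bigr).$$ -/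

import Mathlib

open MeasureTheory TopologicalSpace
open scoped Distributions LineDeriv InnerProductSpace

namespace KirchhoffLove

noncomputable section

/-- The Euclidean plane. -/
abbrev Plane : Type := EuclideanSpace ℝ (Fin 2)

/-- The canonical basis vectors of the plane. For a test function `φ`, the test function
`∂_{e i} φ` is its `i`-th partial derivative. -/
def e (i : Fin 2) : Plane := EuclideanSpace.single i 1

/-- `L²(Ω)`. -/
abbrev L2 (Ω : Opens Plane) : Type := Lp ℝ 2 (volume.restrict (Ω : Set Plane))

/-- `L²(Ω)²` with its Hilbert space norm `‖p‖² = ∑ i, ‖p i‖²`. -/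
abbrev VecL2 (Ω : Opens Plane) : Type := PiLp 2 (fun _ : Fin 2 => L2 Ω)

/-- `L²(Ω)^{2×2}` with its Hilbert space norm `‖M‖² = ∑ i j, ‖M (i, j)‖²`. -/
abbrev TensorL2 (Ω : Opens Plane) : Type := PiLp 2 (fun _ : Fin 2 × Fin 2 => L2 Ω)

/-- The closed subspace of symmetric tensors in `L²(Ω)^{2×2}`. -/
def SymTensorL2 (Ω : Opens Plane) : Submodule ℝ (TensorL2 Ω) where
  carrier := {M | ∀ i j, M (i, j) = M (j, i)}
  add_mem' := fun {M N} hM hN i j => by simp [hM i j, hN i j]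
  zero_mem' := fun i j => by simp
  smul_mem' := fun c M hM i j => by simp [hM i j]

instance (Ω : Opens Plane) : NormedAddCommGroup (SymTensorL2 Ω) := Submodule.normedAddCommGroup _

instance (Ω : Opens Plane) : InnerProductSpace ℝ (SymTensorL2 Ω) := Submodule.innerProductSpace _

instance (Ω : Opens Plane) : NormedSpace ℝ (SymTensorL2 Ω) := InnerProductSpace.toNormedSpace

/-- The action `∫_Ω u φ` of `u ∈ L²(Ω)` on a test function `φ ∈ C_c^∞(Ω)`. -/
def pairing {Ω : Opens Plane} (u : L2 Ω) (φ : 𝓓(Ω, ℝ)) : ℝ :=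
  ∫ x in (Ω : Set Plane), u x * φ x

theorem integrable_mul_test {Ω : Opens Plane} (u : L2 Ω) (φ : 𝓓(Ω, ℝ)) :
    Integrable (fun x => u x * φ x) (volume.restrict (Ω : Set Plane)) := by
  have h : MemLp (φ : Plane → ℝ) 2 (volume.restrict (Ω : Set Plane)) :=
    (φ.continuous.memLp_of_hasCompactSupport φ.hasCompactSupport).restrict _
  exact (Lp.memLp u).integrable_mul h

theorem pairing_add {Ω : Opens Plane} (u v : L2 Ω) (φ : 𝓓(Ω, ℝ)) :
    pairing (u + v) φ = pairing u φ + pairing v φ := by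
  unfold pairing
  rw [← integral_add (integrable_mul_test u φ) (integrable_mul_test v φ)]
  refine integral_congr_ae ?_
  filter_upwards [Lp.coeFn_add u v] with x hx
  rw [hx, Pi.add_apply, add_mul]

theorem pairing_smul {Ω : Opens Plane} (c : ℝ) (u : L2 Ω) (φ : 𝓓(Ω, ℝ)) :
    pairing (c • u) φ = c * pairing u φ := by
  unfold pairing
  rw [← integral_const_mul]
  refine integral_congr_ae ?_
  filter_upwards [Lp.coeFn_smul c u] with x hx
  rw [hx, Pi.smul_apply, smul_eq_mul, mul_assoc]

theorem pairing_zero {Ω : Opens Plane} (φ : 𝓓(Ω, ℝ)) : pairing (0 : L2 Ω) φ = 0 := by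
  simpa using pairing_smul 0 (0 : L2 Ω) φ

/-- An `L²` function is determined by its action on test functions. -/
theorem eq_of_pairing_eq {Ω : Opens Plane} {u v : L2 Ω}
    (h : ∀ φ : 𝓓(Ω, ℝ), pairing u φ = pairing v φ) : u = v := by
  have key : ∀ᵐ x ∂(volume : Measure Plane), x ∈ (Ω : Set Plane) → (u - v : L2 Ω) x = 0 := by
    refine Ω.isOpen.ae_eq_zero_of_integral_contDiff_smul_eq_zero ?_ ?_
    · have h1 : LocallyIntegrable (u - v : L2 Ω) (volume.restrict (Ω : Set Plane)) :=
        (Lp.memLp (u - v)).locallyIntegrable (by norm_num)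
      exact locallyIntegrableOn_of_locallyIntegrable_restrict h1
    · intro g hg hc hs
      let φ : 𝓓(Ω, ℝ) := ⟨g, hg, hc, hs⟩
      have h1 : pairing (u - v) φ = 0 := by
        have : u - v = u + (-1 : ℝ) • v := by simp [sub_eq_add_neg]
        rw [this, pairing_add, pairing_smul, h φ]
        ring
      have h2 : ∫ x in (Ω : Set Plane), g x • (u - v : L2 Ω) x = 0 := by
        rw [← h1]
        refine integral_congr_ae (Filter.Eventually.of_forall fun x => ?_)
        exact mul_comm _ _
      rw [← h2]
      refine (setIntegral_eq_integral_of_forall_compl_eq_zero fun x hx => ?_).symm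
      have : g x = 0 := image_eq_zero_of_notMem_tsupport fun hx' => hx (hs hx')
      simp [this]
  have h3 : u - v = 0 := by
    refine Lp.ext ?_
    have h4 := (ae_restrict_iff' Ω.isOpen.measurableSet).2 key
    filter_upwards [h4, Lp.coeFn_zero ℝ 2 (volume.restrict (Ω : Set Plane))] with x hx hx'
    rw [hx, hx', Pi.zero_apply]
  exact sub_eq_zero.1 h3

/-- `v = ∂_i u` weakly in `Ω`. -/
def IsWeakDeriv {Ω : Opens Plane} (i : Fin 2) (u v : L2 Ω) : Prop :=
  ∀ φ : 𝓓(Ω, ℝ), pairing u (∂_{e i} φ) = -pairing v φ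

/-- `d = div Div M` weakly in `Ω`, where `Div` is the row-wise divergence, that is,
`d = ∑ i, ∂_i (∑ j, ∂_j M_{ij})`. -/
def IsWeakDivDiv {Ω : Opens Plane} (M : TensorL2 Ω) (d : L2 Ω) : Prop :=
  ∀ φ : 𝓓(Ω, ℝ), ∑ i, ∑ j, pairing (M (i, j)) (∂_{e j} (∂_{e i} φ)) = pairing d φ

theorem IsWeakDeriv.unique {Ω : Opens Plane} {i : Fin 2} {u v w : L2 Ω}
    (hv : IsWeakDeriv i u v) (hw : IsWeakDeriv i u w) : v = w :=
  eq_of_pairing_eq fun φ => neg_injective ((hv φ).symm.trans (hw φ))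

theorem IsWeakDivDiv.unique {Ω : Opens Plane} {M : TensorL2 Ω} {d d' : L2 Ω}
    (h : IsWeakDivDiv M d) (h' : IsWeakDivDiv M d') : d = d' :=
  eq_of_pairing_eq fun φ => (h φ).symm.trans (h' φ)

theorem IsWeakDeriv.add {Ω : Opens Plane} {i : Fin 2} {u v u' v' : L2 Ω}
    (h : IsWeakDeriv i u v) (h' : IsWeakDeriv i u' v') : IsWeakDeriv i (u + u') (v + v') :=
  fun φ => by rw [pairing_add, pairing_add, h φ, h' φ]; ring

theorem IsWeakDeriv.smul {Ω : Opens Plane} {i : Fin 2} {u v : L2 Ω} (c : ℝ)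
    (h : IsWeakDeriv i u v) : IsWeakDeriv i (c • u) (c • v) :=
  fun φ => by rw [pairing_smul, pairing_smul, h φ]; ring

theorem IsWeakDeriv.zero {Ω : Opens Plane} (i : Fin 2) : IsWeakDeriv i (0 : L2 Ω) 0 :=
  fun φ => by rw [pairing_zero, pairing_zero, neg_zero]

/-- Partial derivatives of test functions commute. -/
theorem test_deriv_comm {Ω : Opens Plane} (φ : 𝓓(Ω, ℝ)) (v w : Plane) :
    ∂_{v} (∂_{w} φ) = ∂_{w} (∂_{v} φ) := by
  have hd : ∀ (a : Plane) (ψ : 𝓓(Ω, ℝ)), (∂_{a} ψ : 𝓓(Ω, ℝ)) = fun x => fderiv ℝ ψ x a := by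
    intro a ψ
    funext x
    rw [TestFunction.lineDerivOp_eq_lineDerivCLM (𝕜 := ℝ),
      TestFunction.lineDerivCLM_apply_of_le (𝕜 := ℝ) (by simp)]
    exact ((ψ.contDiff.differentiable (by simp)).differentiableAt).lineDeriv_eq_fderiv
  have hD : Differentiable ℝ (fderiv ℝ φ) :=
    (φ.contDiff.fderiv_right (m := 1) (by norm_cast)).differentiable (by simp)
  ext x
  rw [hd, hd, hd, hd]
  beta_reduce
  rw [fderiv_clm_apply hD.differentiableAt (by fun_prop),
    fderiv_clm_apply hD.differentiableAt (by fun_prop)]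
  simp only [fderiv_fun_const, Pi.zero_apply, ContinuousLinearMap.comp_zero, zero_add,
    ContinuousLinearMap.flip_apply]
  exact (φ.contDiff.contDiffAt.isSymmSndFDerivAt (by simp; norm_cast)) v w

/-- `H²(Ω)`: the functions `z ∈ L²(Ω)` whose weak derivatives up to order two are in `L²(Ω)`.
An element is recorded together with its gradient and its Hessian `(∇∇z)_{ij} = ∂_j ∂_i z`, which
`z` determines (see `H2.ext_fn`). In this way the inherited norm is the standard one,
`‖z‖_2² = ‖z‖² + ‖∇z‖² + ‖∇∇z‖²`. -/
def H2 (Ω : Opens Plane) : Submodule ℝ (WithLp 2 (L2 Ω × WithLp 2 (VecL2 Ω × TensorL2 Ω))) where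
  carrier := {z | (∀ i, IsWeakDeriv i z.fst (z.snd.fst i)) ∧
    ∀ i j, IsWeakDeriv j (z.snd.fst i) (z.snd.snd (i, j))}
  add_mem' := fun hz hw =>
    ⟨fun i => (hz.1 i).add (hw.1 i), fun i j => (hz.2 i j).add (hw.2 i j)⟩
  zero_mem' := ⟨fun i => IsWeakDeriv.zero i, fun _ j => IsWeakDeriv.zero j⟩
  smul_mem' := fun c _ hz => ⟨fun i => (hz.1 i).smul c, fun i j => (hz.2 i j).smul c⟩

instance (Ω : Opens Plane) : NormedAddCommGroup (H2 Ω) := Submodule.normedAddCommGroup _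

instance (Ω : Opens Plane) : InnerProductSpace ℝ (H2 Ω) := Submodule.innerProductSpace _

instance (Ω : Opens Plane) : NormedSpace ℝ (H2 Ω) := InnerProductSpace.toNormedSpace

/-- The underlying `L²` function of an element of `H²(Ω)`. -/
def H2.fn (Ω : Opens Plane) : H2 Ω →L[ℝ] L2 Ω :=
  (WithLp.fstL 2 ℝ _ _).comp (H2 Ω).subtypeL

theorem H2.ext_fn {Ω : Opens Plane} {z w : H2 Ω} (h : H2.fn Ω z = H2.fn Ω w) : z = w := by
  obtain ⟨z, hz⟩ := z
  obtain ⟨w, hw⟩ := w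
  have h0 : z.fst = w.fst := h
  have h1 : z.snd.fst = w.snd.fst := by
    ext1 i
    exact (hz.1 i).unique (h0 ▸ hw.1 i)
  have h2 : z.snd.snd = w.snd.snd := by
    ext1 ⟨i, j⟩
    exact (hz.2 i j).unique (h1 ▸ hw.2 i j)
  refine Subtype.ext ?_
  show z = w
  exact WithLp.ofLp_injective 2 (Prod.ext h0 (WithLp.ofLp_injective 2 (Prod.ext h1 h2)))

/-- The Hessian of an `H²` function is a symmetric tensor. -/
theorem H2.hess_symm {Ω : Opens Plane} (z : H2 Ω) : (z : WithLp 2 (L2 Ω × WithLp 2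
    (VecL2 Ω × TensorL2 Ω))).snd.snd ∈ SymTensorL2 Ω := by
  intro i j
  refine eq_of_pairing_eq fun φ => ?_
  have h1 := z.2.2 i j φ
  have h2 := z.2.2 j i φ
  have h3 := z.2.1 i (∂_{e j} φ)
  have h4 := z.2.1 j (∂_{e i} φ)
  rw [test_deriv_comm] at h3
  linarith

/-- The Hessian `∇∇ : H²(Ω) → 𝕃₂ˢ(Ω)`. -/
def H2.hess (Ω : Opens Plane) : H2 Ω →L[ℝ] SymTensorL2 Ω :=
  ((WithLp.sndL 2 ℝ _ _).comp ((WithLp.sndL 2 ℝ _ _).comp (H2 Ω).subtypeL)).codRestrict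
    (SymTensorL2 Ω) H2.hess_symm

/-- `H(div Div, Ω)`: the symmetric `L²` tensors `M` with `div Div M ∈ L²(Ω)`.
An element is recorded together with `div Div M`, which `M` determines (see `HdDiv.ext_tensor`).
In this way the inherited norm is the graph norm, `‖M‖_dDiv² = ‖M‖² + ‖div Div M‖²`. -/
def HdDiv (Ω : Opens Plane) : Submodule ℝ (WithLp 2 (SymTensorL2 Ω × L2 Ω)) where
  carrier := {M | IsWeakDivDiv (M.fst : TensorL2 Ω) M.snd}
  add_mem' := fun {M N} hM hN φ => by
    have h1 : pairing (M + N).snd φ = pairing M.snd φ + pairing N.snd φ := pairing_add _ _ φ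
    rw [h1, ← hM φ, ← hN φ, ← Finset.sum_add_distrib]
    refine Finset.sum_congr rfl fun i _ => ?_
    rw [← Finset.sum_add_distrib]
    exact Finset.sum_congr rfl fun j _ => pairing_add _ _ _
  zero_mem' := fun φ => by
    have h1 : pairing (0 : WithLp 2 (SymTensorL2 Ω × L2 Ω)).snd φ = 0 := pairing_zero φ
    rw [h1]
    exact Finset.sum_eq_zero fun i _ => Finset.sum_eq_zero fun j _ => pairing_zero _
  smul_mem' := fun c M hM φ => by
    have h1 : pairing (c • M).snd φ = c * pairing M.snd φ := pairing_smul c _ φ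
    rw [h1, ← hM φ, Finset.mul_sum]
    refine Finset.sum_congr rfl fun i _ => ?_
    rw [Finset.mul_sum]
    exact Finset.sum_congr rfl fun j _ => pairing_smul c _ _

instance (Ω : Opens Plane) : NormedAddCommGroup (HdDiv Ω) := Submodule.normedAddCommGroup _

instance (Ω : Opens Plane) : InnerProductSpace ℝ (HdDiv Ω) := Submodule.innerProductSpace _

instance (Ω : Opens Plane) : NormedSpace ℝ (HdDiv Ω) := InnerProductSpace.toNormedSpace

/-- The underlying symmetric tensor of an element of `H(div Div, Ω)`. -/
def HdDiv.tensor (Ω : Opens Plane) : HdDiv Ω →L[ℝ] SymTensorL2 Ω :=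
  (WithLp.fstL 2 ℝ _ _).comp (HdDiv Ω).subtypeL

/-- The operator `div Div : H(div Div, Ω) → L²(Ω)`. -/
def HdDiv.divDiv (Ω : Opens Plane) : HdDiv Ω →L[ℝ] L2 Ω :=
  (WithLp.sndL 2 ℝ _ _).comp (HdDiv Ω).subtypeL

theorem HdDiv.ext_tensor {Ω : Opens Plane} {M N : HdDiv Ω}
    (h : HdDiv.tensor Ω M = HdDiv.tensor Ω N) : M = N := by
  obtain ⟨M, hM⟩ := M
  obtain ⟨N, hN⟩ := N
  have h0 : M.fst = N.fst := h
  have h1 : M.snd = N.snd := by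
    have hM' : IsWeakDivDiv (M.fst : TensorL2 Ω) M.snd := hM
    have hN' : IsWeakDivDiv (N.fst : TensorL2 Ω) N.snd := hN
    rw [h0] at hM'
    exact hM'.unique hN'
  refine Subtype.ext ?_
  show M = N
  exact WithLp.ofLp_injective 2 (Prod.ext h0 h1)

/-- The trace operator `tr^dDiv : H(div Div, Ω) → H²(Ω)'`,
`⟨tr^dDiv M, z⟩ = (div Div M, z) - (M, ∇∇z)`. -/
def trdDiv (Ω : Opens Plane) : HdDiv Ω →L[ℝ] StrongDual ℝ (H2 Ω) :=
  (innerSL ℝ : L2 Ω →L[ℝ] L2 Ω →L[ℝ] ℝ).bilinearComp (HdDiv.divDiv Ω) (H2.fn Ω) -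
    (innerSL ℝ : SymTensorL2 Ω →L[ℝ] SymTensorL2 Ω →L[ℝ] ℝ).bilinearComp
      (HdDiv.tensor Ω) (H2.hess Ω)

theorem trdDiv_apply {Ω : Opens Plane} (M : HdDiv Ω) (z : H2 Ω) :
    trdDiv Ω M z = ⟪HdDiv.divDiv Ω M, H2.fn Ω z⟫_ℝ - ⟪HdDiv.tensor Ω M, H2.hess Ω z⟫_ℝ := rfl

/-- The trace operator `tr^Ggrad : H²(Ω) → H(div Div, Ω)'`, `⟨tr^Ggrad z, M⟩ = ⟨tr^dDiv M, z⟩`. -/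
def trGgrad (Ω : Opens Plane) : H2 Ω →L[ℝ] StrongDual ℝ (HdDiv Ω) :=
  (trdDiv Ω).flip

/-- The trace space `H^{3/2,1/2}(Γ) = tr^Ggrad (H²(Ω))`. -/
def H32 (Ω : Opens Plane) : Submodule ℝ (StrongDual ℝ (HdDiv Ω)) :=
  LinearMap.range (trGgrad Ω).toLinearMap

/-- The induced trace norm `‖g‖_{3/2,1/2,Γ} = inf {‖z‖_2 ; z ∈ H²(Ω), tr^Ggrad z = g}`. -/
def traceNorm {Ω : Opens Plane} (g : H32 Ω) : ℝ :=
  sInf {r | ∃ z : H2 Ω, trGgrad Ω z = g ∧ ‖z‖ = r}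

/-- The duality `⟨tr^dDiv M, g⟩_Γ` for `g ∈ H^{3/2,1/2}(Γ)`; it equals `⟨tr^dDiv M, z⟩` for every
`z ∈ H²(Ω)` with `tr^Ggrad z = g` (see `bdryDual_eq`). -/
def bdryDual {Ω : Opens Plane} (M : HdDiv Ω) (g : H32 Ω) : ℝ :=
  (g : StrongDual ℝ (HdDiv Ω)) M

theorem bdryDual_eq {Ω : Opens Plane} (M : HdDiv Ω) (g : H32 Ω) (z : H2 Ω)
    (hz : trGgrad Ω z = g) : bdryDual M g = trdDiv Ω M z := by
  unfold bdryDual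
  rw [← hz]
  rfl

/-- `(u, M) ∈ L²(Ω) × H(div Div, Ω)` solves the mixed Kirchhoff-Love problem with material
operator `C`, load `f` and Dirichlet data `g`. -/
structure IsMixedSolution {Ω : Opens Plane} (C : SymTensorL2 Ω ≃L[ℝ] SymTensorL2 Ω)
    (f : L2 Ω) (g : H32 Ω) (u : L2 Ω) (M : HdDiv Ω) : Prop where
  constitutive : ∀ N : HdDiv Ω,
    ⟪C.symm (HdDiv.tensor Ω M), HdDiv.tensor Ω N⟫_ℝ - ⟪u, HdDiv.divDiv Ω N⟫_ℝ = -bdryDual N g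
  equilibrium : ∀ v : L2 Ω, ⟪HdDiv.divDiv Ω M, v⟫_ℝ = ⟪f, v⟫_ℝ

end

end KirchhoffLove

/-!
The mixed problem is the primal plate problem in disguise. Let `H²₀(Ω)` be the closure of the test
functions in `H²(Ω)`. The trace `tr^Ggrad` vanishes on it, by the definition of the weak `div Div`
(`trGgrad_eq_zero`), and since `Ω` is bounded, the Poincaré inequality for test functions, applied
twice, shows that the Hessian controls the full `H²` norm there (`exists_norm_sq_le_hess`). Hence
the form `(C ∇∇w, ∇∇v)` is coercive on `H²₀(Ω)`, and the Lax–Milgram lemma solves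
`div Div (C ∇∇w) = f` with `tr^Ggrad w = tr^Ggrad z` and `‖w‖_2 ≤ c (‖f‖ + ‖z‖_2)`, for every
`z ∈ H²(Ω)` (`exists_clamped_plate`). The operator `C` need not be symmetric.

By the definition of the traces, `(w, C ∇∇w)` then solves the mixed problem with `g = tr^Ggrad z`
(`isMixedSolution_of_hess`). Mixed solutions are unique (`IsMixedSolution.unique`): the moments by
coercivity, and the deflection because `div Div` maps onto `L²(Ω)`, which is again the plate problem,
now with `C = 1`. So every mixed solution is the constructed one, for every extension `z` of `g`,
and the infimum over `z` turns `‖z‖_2` into the trace norm of `g`.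
No regularity of the boundary enters.
-/

namespace KirchhoffLove

noncomputable section

/-! ### Test functions as elements of `L²(Ω)` -/

theorem memLp_test {Ω : Opens Plane} (φ : 𝓓(Ω, ℝ)) :
    MemLp (φ : Plane → ℝ) 2 (volume.restrict (Ω : Set Plane)) :=
  (φ.continuous.memLp_of_hasCompactSupport φ.hasCompactSupport).restrict _

/-- The embedding `C_c^∞(Ω) → L²(Ω)`. -/
def testL2 (Ω : Opens Plane) : 𝓓(Ω, ℝ) →ₗ[ℝ] L2 Ω where
  toFun φ := (memLp_test φ).toLp φ
  map_add' _ _ := rfl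
  map_smul' _ _ := rfl

theorem pairing_eq_inner {Ω : Opens Plane} (u : L2 Ω) (φ : 𝓓(Ω, ℝ)) :
    pairing u φ = ⟪u, testL2 Ω φ⟫_ℝ := by
  rw [L2.inner_def]
  refine integral_congr_ae ?_
  filter_upwards [(memLp_test φ).coeFn_toLp] with x hx
  change _ = inner ℝ (u x) ((memLp_test φ).toLp φ x)
  rw [hx]
  exact mul_comm _ _

theorem test_deriv_apply {Ω : Opens Plane} (a : Plane) (φ : 𝓓(Ω, ℝ)) (x : Plane) :
    (∂_{a} φ : 𝓓(Ω, ℝ)) x = fderiv ℝ φ x a := by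
  rw [TestFunction.lineDerivOp_eq_lineDerivCLM (𝕜 := ℝ),
    TestFunction.lineDerivCLM_apply_of_le (𝕜 := ℝ) (by simp)]
  exact ((φ.contDiff.differentiable (by simp)).differentiableAt).lineDeriv_eq_fderiv

theorem integral_mul_test_eq {Ω : Opens Plane} (f : Plane → ℝ) (ψ : 𝓓(Ω, ℝ)) :
    ∫ x in (Ω : Set Plane), f x * ψ x = ∫ x, f x * ψ x := by
  refine setIntegral_eq_integral_of_forall_compl_eq_zero fun x hx => ?_
  have : ψ x = 0 := image_eq_zero_of_notMem_tsupport fun hx' => hx (ψ.tsupport_subset hx')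
  rw [this, mul_zero]

theorem integrable_continuous_mul_test {Ω : Opens Plane} {f : Plane → ℝ} (hf : Continuous f)
    (ψ : 𝓓(Ω, ℝ)) : Integrable (fun x => f x * ψ x) :=
  (hf.mul ψ.continuous).integrable_of_hasCompactSupport ψ.hasCompactSupport.mul_left

theorem inner_testL2_eq_integral {Ω : Opens Plane} (φ ψ : 𝓓(Ω, ℝ)) :
    ⟪testL2 Ω φ, testL2 Ω ψ⟫_ℝ = ∫ x, φ x * ψ x := by
  rw [← pairing_eq_inner, pairing, ← integral_mul_test_eq]
  refine integral_congr_ae ?_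
  filter_upwards [(memLp_test φ).coeFn_toLp] with x hx
  change (memLp_test φ).toLp φ x * _ = _
  rw [hx]

/-- Classical partial derivatives of test functions are weak derivatives. -/
theorem isWeakDeriv_testL2 {Ω : Opens Plane} (i : Fin 2) (φ : 𝓓(Ω, ℝ)) :
    IsWeakDeriv i (testL2 Ω φ) (testL2 Ω (∂_{e i} φ)) := by
  intro ψ
  rw [pairing_eq_inner, pairing_eq_inner, inner_testL2_eq_integral, inner_testL2_eq_integral]
  have h1 := integrable_continuous_mul_test (∂_{e i} φ : 𝓓(Ω, ℝ)).continuous ψ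
  have h2 := integrable_continuous_mul_test φ.continuous (∂_{e i} ψ : 𝓓(Ω, ℝ))
  simp only [test_deriv_apply] at h1 h2 ⊢
  exact integral_mul_fderiv_eq_neg_fderiv_mul_of_integrable h1 h2
    (integrable_continuous_mul_test φ.continuous ψ)
    (fun x _ => φ.contDiff.differentiable (by simp) x)
    (fun x _ => ψ.contDiff.differentiable (by simp) x)

/-- **Poincaré inequality** for test functions. It comes from `∂ᵢxᵢ = 1`, which gives
`‖φ‖² = -2 (xᵢ φ, ∂ᵢφ)`, and from `|xᵢ| ≤ R` on `Ω`. -/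
theorem norm_testL2_le {Ω : Opens Plane} {R : ℝ} (hR : ∀ x ∈ Ω, ‖x‖ ≤ R) (hR0 : 0 ≤ R) (i : Fin 2)
    (φ : 𝓓(Ω, ℝ)) : ‖testL2 Ω φ‖ ≤ 2 * R * ‖testL2 Ω (∂_{e i} φ)‖ := by
  have hφd : Differentiable ℝ φ := φ.contDiff.differentiable (by simp)
  have hc : Continuous fun x : Plane => x i := by fun_prop
  have hxd : ∀ x : Plane, HasFDerivAt (fun x : Plane => x i)
      (EuclideanSpace.proj i : Plane →L[ℝ] ℝ) x :=
    fun x => (EuclideanSpace.proj i : Plane →L[ℝ] ℝ).hasFDerivAt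
  have hm : MemLp (fun x : Plane => x i * φ x) 2 (volume.restrict (Ω : Set Plane)) :=
    ((hc.mul φ.continuous).memLp_of_hasCompactSupport φ.hasCompactSupport.mul_left).restrict _
  -- integration by parts of `xᵢ` against `∂ᵢ(φ²)`
  have hparts : ⟪testL2 Ω φ, testL2 Ω φ⟫_ℝ = -2 * ⟪hm.toLp _, testL2 Ω (∂_{e i} φ)⟫_ℝ := by
    have h1 : ∀ x, fderiv ℝ (fun x => φ x * φ x) x (e i) = 2 * (φ x * fderiv ℝ φ x (e i)) := by
      intro x
      rw [fderiv_fun_mul (hφd x) (hφd x)]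
      simp only [add_apply, smul_apply, smul_eq_mul]
      ring
    have h2 : ∀ x, fderiv ℝ (fun x : Plane => x i) x (e i) = 1 := by
      intro x
      rw [(hxd x).fderiv]
      simp [e]
    have h3 := integral_mul_fderiv_eq_neg_fderiv_mul_of_integrable (μ := volume)
      (f := fun x : Plane => x i) (g := fun x => φ x * φ x) (v := e i) ?_ ?_ ?_
      (fun x _ => (hxd x).differentiableAt) (fun x _ => (hφd x).mul (hφd x))
    · simp only [h1, h2, one_mul] at h3
      have h4 : ⟪hm.toLp _, testL2 Ω (∂_{e i} φ)⟫_ℝ =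
          ∫ x : Plane, x i * φ x * (∂_{e i} φ : 𝓓(Ω, ℝ)) x := by
        rw [← pairing_eq_inner, pairing, ← integral_mul_test_eq]
        refine integral_congr_ae ?_
        filter_upwards [hm.coeFn_toLp] with x hx
        rw [hx]
      rw [inner_testL2_eq_integral, h4, ← neg_eq_iff_eq_neg.2 h3, ← integral_neg,
        ← integral_const_mul]
      refine integral_congr_ae (Filter.Eventually.of_forall fun x => ?_)
      simp only [test_deriv_apply]
      ring
    · simpa only [h2, one_mul] using integrable_continuous_mul_test φ.continuous φ
    · simp only [h1]
      refine (integrable_continuous_mul_test (f := fun x : Plane => x i * (2 * φ x))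
        (by have := φ.continuous; fun_prop) (∂_{e i} φ : 𝓓(Ω, ℝ))).congr ?_
      refine Filter.Eventually.of_forall fun x => ?_
      simp only [test_deriv_apply]
      ring
    · refine (integrable_continuous_mul_test (f := fun x : Plane => x i * φ x)
        (by have := φ.continuous; fun_prop) φ).congr ?_
      exact Filter.Eventually.of_forall fun x => by ring
  have hbound : ‖hm.toLp _‖ ≤ R * ‖testL2 Ω φ‖ := by
    refine Lp.norm_le_mul_norm_of_ae_le_mul ?_
    filter_upwards [hm.coeFn_toLp, (memLp_test φ).coeFn_toLp,
      ae_restrict_mem Ω.isOpen.measurableSet] with x h1 h2 hx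
    change _ ≤ R * ‖(memLp_test φ).toLp φ x‖
    rw [h1, h2, norm_mul]
    exact mul_le_mul_of_nonneg_right ((PiLp.norm_apply_le x i).trans (hR x hx)) (norm_nonneg _)
  have hcs := abs_le.1 (abs_real_inner_le_norm (hm.toLp _) (testL2 Ω (∂_{e i} φ)))
  have hprod := mul_le_mul_of_nonneg_right hbound (norm_nonneg (testL2 Ω (∂_{e i} φ)))
  rw [real_inner_self_eq_norm_sq] at hparts
  rcases (norm_nonneg (testL2 Ω φ)).eq_or_lt with h0 | h0
  · rw [← h0]
    positivity
  · refine le_of_mul_le_mul_left ?_ h0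
    linarith

/-! ### The space `H²₀(Ω)` -/

/-- The embedding `C_c^∞(Ω) → H²(Ω)`. -/
def testH2 (Ω : Opens Plane) : 𝓓(Ω, ℝ) →ₗ[ℝ] H2 Ω where
  toFun φ := ⟨WithLp.toLp 2 (testL2 Ω φ, WithLp.toLp 2
      (WithLp.toLp 2 fun i => testL2 Ω (∂_{e i} φ),
        WithLp.toLp 2 fun ij : Fin 2 × Fin 2 => testL2 Ω (∂_{e ij.2} (∂_{e ij.1} φ)))),
    fun i => isWeakDeriv_testL2 i φ, fun i j => isWeakDeriv_testL2 j (∂_{e i} φ)⟩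
  map_add' φ ψ := H2.ext_fn (map_add (testL2 Ω) φ ψ)
  map_smul' c φ := H2.ext_fn (map_smul (testL2 Ω) c φ)

theorem fn_testH2 {Ω : Opens Plane} (φ : 𝓓(Ω, ℝ)) : H2.fn Ω (testH2 Ω φ) = testL2 Ω φ := rfl

theorem hess_testH2 {Ω : Opens Plane} (φ : 𝓓(Ω, ℝ)) (i j : Fin 2) :
    (H2.hess Ω (testH2 Ω φ) : TensorL2 Ω) (i, j) = testL2 Ω (∂_{e j} (∂_{e i} φ)) := rfl

/-- The Poincaré inequality, applied to `φ` and to its first derivatives, bounds the `H²` norm by the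
Hessian. -/
theorem norm_sq_testH2_le {Ω : Opens Plane} {R : ℝ} (hR : ∀ x ∈ Ω, ‖x‖ ≤ R) (hR0 : 0 ≤ R)
    (φ : 𝓓(Ω, ℝ)) :
    ‖testH2 Ω φ‖ ^ 2 ≤
      ((2 * R) ^ 4 + 2 * (2 * R) ^ 2 + 1) * ‖H2.hess Ω (testH2 Ω φ)‖ ^ 2 := by
  have hD : 0 ≤ 2 * R := by positivity
  set h := ‖H2.hess Ω (testH2 Ω φ)‖ with hh
  have h2 : ∀ i, ‖testL2 Ω (∂_{e i} φ)‖ ≤ 2 * R * h := fun i =>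
    (norm_testL2_le hR hR0 i _).trans <| mul_le_mul_of_nonneg_left
      (PiLp.norm_apply_le (H2.hess Ω (testH2 Ω φ) : TensorL2 Ω) (i, i)) hD
  have h1 : ‖testL2 Ω φ‖ ≤ 2 * R * (2 * R * h) :=
    (norm_testL2_le hR hR0 0 φ).trans (mul_le_mul_of_nonneg_left (h2 0) hD)
  have hn : ‖testH2 Ω φ‖ ^ 2 = ‖testL2 Ω φ‖ ^ 2 +
      ((‖testL2 Ω (∂_{e 0} φ)‖ ^ 2 + ‖testL2 Ω (∂_{e 1} φ)‖ ^ 2) + h ^ 2) := by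
    rw [Submodule.coe_norm, WithLp.prod_norm_sq_eq_of_L2, WithLp.prod_norm_sq_eq_of_L2,
      PiLp.norm_sq_eq_of_L2, Fin.sum_univ_two]
    rfl
  have e1 := pow_le_pow_left₀ (norm_nonneg _) h1 2
  have e2 := pow_le_pow_left₀ (norm_nonneg _) (h2 0) 2
  have e3 := pow_le_pow_left₀ (norm_nonneg _) (h2 1) 2
  rw [hn]
  calc _ ≤ (2 * R * (2 * R * h)) ^ 2 + ((2 * R * h) ^ 2 + (2 * R * h) ^ 2 + h ^ 2) := by gcongr
    _ = _ := by ring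

/-- `H²(Ω)` is complete: each of its defining identities is closed in the ambient Hilbert space. -/
instance completeSpace_H2 (Ω : Opens Plane) : CompleteSpace (H2 Ω) := by
  have hset : ((H2 Ω : Submodule ℝ _) : Set (WithLp 2 (L2 Ω × WithLp 2 (VecL2 Ω × TensorL2 Ω)))) =
      {z | (∀ i (φ : 𝓓(Ω, ℝ)), ⟪z.fst, testL2 Ω (∂_{e i} φ)⟫_ℝ = -⟪z.snd.fst i, testL2 Ω φ⟫_ℝ) ∧
        ∀ i j (φ : 𝓓(Ω, ℝ)),
          ⟪z.snd.fst i, testL2 Ω (∂_{e j} φ)⟫_ℝ = -⟪z.snd.snd (i, j), testL2 Ω φ⟫_ℝ} := by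
    ext z
    simp only [← pairing_eq_inner]
    rfl
  refine IsClosed.completeSpace_coe (s := ((H2 Ω : Submodule ℝ _) :
    Set (WithLp 2 (L2 Ω × WithLp 2 (VecL2 Ω × TensorL2 Ω))))) (hs := ?_)
  rw [hset]
  simp only [Set.ofPred_and, Set.ofPred_forall]
  refine IsClosed.inter (isClosed_iInter fun i => isClosed_iInter fun φ => ?_)
    (isClosed_iInter fun i => isClosed_iInter fun j => isClosed_iInter fun φ => ?_)
  · exact isClosed_eq (by fun_prop) (by fun_prop)
  · exact isClosed_eq (by fun_prop) (by fun_prop)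

/-- `H²₀(Ω)`: the closure of the test functions in `H²(Ω)`. -/
def H20 (Ω : Opens Plane) : Submodule ℝ (H2 Ω) := (LinearMap.range (testH2 Ω)).topologicalClosure

instance (Ω : Opens Plane) : NormedAddCommGroup (H20 Ω) := Submodule.normedAddCommGroup _

instance (Ω : Opens Plane) : InnerProductSpace ℝ (H20 Ω) := Submodule.innerProductSpace _

instance (Ω : Opens Plane) : CompleteSpace (H20 Ω) :=
  (Submodule.isClosed_topologicalClosure _).completeSpace_coe

theorem testH2_mem_H20 {Ω : Opens Plane} (φ : 𝓓(Ω, ℝ)) : testH2 Ω φ ∈ H20 Ω :=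
  Submodule.le_topologicalClosure _ ⟨φ, rfl⟩

/-- A closed condition on `H²(Ω)` holds on `H²₀(Ω)` as soon as it holds for test functions. -/
theorem H20_induction {Ω : Opens Plane} {p : H2 Ω → Prop} (hp : IsClosed {z | p z})
    (h : ∀ φ, p (testH2 Ω φ)) {z : H2 Ω} (hz : z ∈ H20 Ω) : p z := by
  have hsub : closure (LinearMap.range (testH2 Ω) : Set (H2 Ω)) ⊆ {z | p z} :=
    closure_minimal (by rintro _ ⟨φ, rfl⟩; exact h φ) hp
  exact hsub hz

/-- On `H²₀(Ω)` the `H²` norm is controlled by the Hessian. -/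
theorem exists_norm_sq_le_hess {Ω : Opens Plane} (hΩ : Bornology.IsBounded (Ω : Set Plane)) :
    ∃ K : ℝ, 0 < K ∧ ∀ z ∈ H20 Ω, ‖z‖ ^ 2 ≤ K * ‖H2.hess Ω z‖ ^ 2 := by
  obtain ⟨R, hR0, hR⟩ := hΩ.exists_pos_norm_le
  refine ⟨(2 * R) ^ 4 + 2 * (2 * R) ^ 2 + 1, by positivity, fun z hz => ?_⟩
  refine H20_induction (p := fun z => ‖z‖ ^ 2 ≤ _ * ‖H2.hess Ω z‖ ^ 2) ?_
    (fun φ => norm_sq_testH2_le hR hR0.le φ) hz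
  exact isClosed_le (by fun_prop) (by fun_prop)

/-- `tr^Ggrad` vanishes on `H²₀(Ω)`: for a test function `φ` the identity `tr^Ggrad φ = 0` is the
definition of the weak `div Div`. -/
theorem trGgrad_eq_zero {Ω : Opens Plane} {z : H2 Ω} (hz : z ∈ H20 Ω) : trGgrad Ω z = 0 := by
  refine H20_induction (p := fun z => trGgrad Ω z = 0)
    (isClosed_eq (by fun_prop) continuous_const) (fun φ => ?_) hz
  ext M
  have hM : ∑ i, ∑ j, pairing ((HdDiv.tensor Ω M : TensorL2 Ω) (i, j)) (∂_{e j} (∂_{e i} φ)) =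
      pairing (HdDiv.divDiv Ω M) φ := M.2 φ
  change ⟪HdDiv.divDiv Ω M, H2.fn Ω (testH2 Ω φ)⟫_ℝ -
    ⟪HdDiv.tensor Ω M, H2.hess Ω (testH2 Ω φ)⟫_ℝ = 0
  rw [Submodule.coe_inner, PiLp.inner_apply, Fintype.sum_prod_type, fn_testH2]
  simp only [hess_testH2, ← pairing_eq_inner]
  rw [hM, sub_self]

/-! ### The clamped plate problem -/

/-- The Lax–Milgram lemma with its a priori bound. -/
theorem exists_of_coercive {V : Type*} [NormedAddCommGroup V] [InnerProductSpace ℝ V]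
    [CompleteSpace V] (B : V →L[ℝ] V →L[ℝ] ℝ) {β : ℝ} (hβ : 0 < β)
    (hB : ∀ v, β * ‖v‖ ^ 2 ≤ B v v) (l : StrongDual ℝ V) :
    ∃ w, (∀ v, B w v = l v) ∧ ‖w‖ ≤ β⁻¹ * ‖l‖ := by
  have hco : IsCoercive B := ⟨β, hβ, fun v => by simpa [pow_two, mul_assoc] using hB v⟩
  refine ⟨hco.continuousLinearEquivOfBilin.symm ((InnerProductSpace.toDual ℝ V).symm l), ?_, ?_⟩
  · intro v
    rw [← hco.continuousLinearEquivOfBilin_apply, ContinuousLinearEquiv.apply_symm_apply,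
      InnerProductSpace.toDual_symm_apply]
  · set w := hco.continuousLinearEquivOfBilin.symm ((InnerProductSpace.toDual ℝ V).symm l)
    have h1 : B w w = l w := by
      rw [← hco.continuousLinearEquivOfBilin_apply, ContinuousLinearEquiv.apply_symm_apply,
        InnerProductSpace.toDual_symm_apply]
    have h2 : β * ‖w‖ ^ 2 ≤ ‖l‖ * ‖w‖ :=
      (hB w).trans (h1.trans_le ((le_abs_self _).trans (l.le_opNorm w)))
    rw [← div_eq_inv_mul, le_div_iff₀ hβ]
    rcases (norm_nonneg w).eq_or_lt with h0 | h0
    · rw [← h0, zero_mul]; exact norm_nonneg l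
    · refine le_of_mul_le_mul_right ?_ h0
      linarith

theorem norm_hess_le {Ω : Opens Plane} (z : H2 Ω) : ‖H2.hess Ω z‖ ≤ ‖z‖ :=
  (WithLp.norm_snd_le _ _).trans
    (WithLp.norm_snd_le _ (z : WithLp 2 (L2 Ω × WithLp 2 (VecL2 Ω × TensorL2 Ω))))

theorem norm_fn_le {Ω : Opens Plane} (z : H2 Ω) : ‖H2.fn Ω z‖ ≤ ‖z‖ :=
  WithLp.norm_fst_le _ (z : WithLp 2 (L2 Ω × WithLp 2 (VecL2 Ω × TensorL2 Ω)))

theorem norm_HdDiv_le {Ω : Opens Plane} (M : HdDiv Ω) :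
    ‖M‖ ≤ ‖HdDiv.tensor Ω M‖ + ‖HdDiv.divDiv Ω M‖ := by
  refine le_of_sq_le_sq ?_ (by positivity)
  have h : ‖M‖ ^ 2 = ‖HdDiv.tensor Ω M‖ ^ 2 + ‖HdDiv.divDiv Ω M‖ ^ 2 :=
    WithLp.prod_norm_sq_eq_of_L2 (M : WithLp 2 (SymTensorL2 Ω × L2 Ω))
  nlinarith [mul_nonneg (norm_nonneg (HdDiv.tensor Ω M)) (norm_nonneg (HdDiv.divDiv Ω M))]

set_option maxHeartbeats 1000000 in
/-- Solvability of the clamped plate problem `div Div (C ∇∇w) = f` with the boundary data of a given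
`z ∈ H²(Ω)`. The solution is sought as `w = z + w₀` with `w₀ ∈ H²₀(Ω)`. -/
theorem exists_clamped_plate {Ω : Opens Plane} (hΩ : Bornology.IsBounded (Ω : Set Plane))
    (C : SymTensorL2 Ω →L[ℝ] SymTensorL2 Ω)
    (hC : ∃ α : ℝ, 0 < α ∧ ∀ N : SymTensorL2 Ω, α * ‖N‖ ^ 2 ≤ ⟪C N, N⟫_ℝ) :
    ∃ c : ℝ, 0 < c ∧ ∀ (f : L2 Ω) (z : H2 Ω), ∃ (w : H2 Ω) (M : HdDiv Ω),
      trGgrad Ω w = trGgrad Ω z ∧ HdDiv.tensor Ω M = C (H2.hess Ω w) ∧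
      HdDiv.divDiv Ω M = f ∧ ‖w‖ ≤ c * (‖f‖ + ‖z‖) := by
  obtain ⟨α, hα, hC⟩ := hC
  obtain ⟨K, hK, hK'⟩ := exists_norm_sq_le_hess hΩ
  let hess₀ : H20 Ω →L[ℝ] SymTensorL2 Ω := (H2.hess Ω).comp (H20 Ω).subtypeL
  let fn₀ : H20 Ω →L[ℝ] L2 Ω := (H2.fn Ω).comp (H20 Ω).subtypeL
  let B : H20 Ω →L[ℝ] H20 Ω →L[ℝ] ℝ :=
    (innerSL ℝ : SymTensorL2 Ω →L[ℝ] SymTensorL2 Ω →L[ℝ] ℝ).bilinearComp (C.comp hess₀) hess₀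
  have hβ : 0 < α / K := div_pos hα hK
  have hB : ∀ v, α / K * ‖v‖ ^ 2 ≤ B v v := fun v => by
    refine le_trans ?_ (hC (hess₀ v))
    rw [div_mul_eq_mul_div, div_le_iff₀ hK, mul_assoc, mul_comm _ K]
    exact mul_le_mul_of_nonneg_left (hK' v v.2) hα.le
  refine ⟨1 + (α / K)⁻¹ * (1 + ‖C‖), by positivity, fun f z => ?_⟩
  let l : StrongDual ℝ (H20 Ω) :=
    (innerSL ℝ f).comp fn₀ - (innerSL ℝ (C (H2.hess Ω z))).comp hess₀
  obtain ⟨w, hw, hwl⟩ := exists_of_coercive B hβ hB l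
  have hl : ‖l‖ ≤ (1 + ‖C‖) * (‖f‖ + ‖z‖) := by
    refine l.opNorm_le_bound (by positivity) fun v => ?_
    have h1 : |⟪f, fn₀ v⟫_ℝ| ≤ ‖f‖ * ‖v‖ := (abs_real_inner_le_norm _ _).trans
      (mul_le_mul_of_nonneg_left (norm_fn_le (v : H2 Ω)) (norm_nonneg f))
    have h2 : |⟪C (H2.hess Ω z), hess₀ v⟫_ℝ| ≤ ‖C‖ * ‖z‖ * ‖v‖ := by
      refine (abs_real_inner_le_norm _ _).trans ?_
      exact mul_le_mul ((C.le_opNorm _).trans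
        (mul_le_mul_of_nonneg_left (norm_hess_le z) (norm_nonneg C)))
        (norm_hess_le (v : H2 Ω)) (norm_nonneg _) (by positivity)
    have h3 : ‖l v‖ ≤ |⟪f, fn₀ v⟫_ℝ| + |⟪C (H2.hess Ω z), hess₀ v⟫_ℝ| := abs_sub _ _
    have h4 : 0 ≤ ‖C‖ * ‖f‖ * ‖v‖ := by positivity
    have h5 : 0 ≤ ‖z‖ * ‖v‖ := by positivity
    linarith
  -- Testing the variational equation with test functions only is the weak form of
  -- `div Div (C ∇∇(z + w)) = f`.
  have hdiv : IsWeakDivDiv (C (H2.hess Ω (z + w)) : TensorL2 Ω) f := fun φ => by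
    have h1 : ⟪C (H2.hess Ω w), H2.hess Ω (testH2 Ω φ)⟫_ℝ = ⟪f, testL2 Ω φ⟫_ℝ -
      ⟪C (H2.hess Ω z), H2.hess Ω (testH2 Ω φ)⟫_ℝ := hw ⟨testH2 Ω φ, testH2_mem_H20 φ⟩
    have h2 : ⟪C (H2.hess Ω (z + w)), H2.hess Ω (testH2 Ω φ)⟫_ℝ = ⟪f, testL2 Ω φ⟫_ℝ := by
      rw [map_add, map_add, inner_add_left, h1]
      ring
    rw [Submodule.coe_inner, PiLp.inner_apply, Fintype.sum_prod_type] at h2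
    simpa only [hess_testH2, ← pairing_eq_inner] using h2
  refine ⟨z + w, ⟨WithLp.toLp 2 (C (H2.hess Ω (z + w)), f), hdiv⟩, ?_, rfl, rfl, ?_⟩
  · rw [map_add, trGgrad_eq_zero w.2, add_zero]
  · have h1 : ‖(w : H2 Ω)‖ ≤ (α / K)⁻¹ * ((1 + ‖C‖) * (‖f‖ + ‖z‖)) :=
      hwl.trans (mul_le_mul_of_nonneg_left hl (inv_nonneg.2 hβ.le))
    have h2 := norm_add_le z (w : H2 Ω)
    have h3 := norm_nonneg f
    linarith

/-- `div Div : H(div Div, Ω) → L²(Ω)` is onto, by the clamped plate problem with `C = 1`. -/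
theorem exists_divDiv_eq {Ω : Opens Plane} (hΩ : Bornology.IsBounded (Ω : Set Plane))
    (f : L2 Ω) : ∃ M : HdDiv Ω, HdDiv.divDiv Ω M = f := by
  obtain ⟨c, -, h⟩ := exists_clamped_plate hΩ (ContinuousLinearMap.id ℝ (SymTensorL2 Ω))
    ⟨1, one_pos, fun N => by simp⟩
  obtain ⟨w, M, -, -, hM, -⟩ := h f 0
  exact ⟨M, hM⟩

/-! ### The mixed problem -/

set_option maxHeartbeats 1000000 in
/-- The mixed problem has at most one solution: testing the difference with itself gives `M = M'`
by coercivity, and then `u - u'` is orthogonal to the range of `div Div`, which is all of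
`L²(Ω)`. -/
theorem IsMixedSolution.unique {Ω : Opens Plane} (hΩ : Bornology.IsBounded (Ω : Set Plane))
    {C : SymTensorL2 Ω ≃L[ℝ] SymTensorL2 Ω}
    (hC : ∃ α : ℝ, 0 < α ∧ ∀ N : SymTensorL2 Ω, α * ‖N‖ ^ 2 ≤ ⟪C N, N⟫_ℝ)
    {f : L2 Ω} {g : H32 Ω} {u u' : L2 Ω} {M M' : HdDiv Ω}
    (h : IsMixedSolution C f g u M) (h' : IsMixedSolution C f g u' M') : u = u' ∧ M = M' := by
  obtain ⟨α, hα, hC⟩ := hC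
  have hdiv : HdDiv.divDiv Ω M = HdDiv.divDiv Ω M' :=
    ext_inner_right ℝ fun v => (h.equilibrium v).trans (h'.equilibrium v).symm
  have hdiff : ∀ N : HdDiv Ω, ⟪C.symm (HdDiv.tensor Ω (M - M')), HdDiv.tensor Ω N⟫_ℝ =
      ⟪u - u', HdDiv.divDiv Ω N⟫_ℝ := fun N => by
    rw [map_sub, map_sub, inner_sub_left, inner_sub_left]
    linarith [h.constitutive N, h'.constitutive N]
  have hM : M = M' := by
    have h1 := hdiff (M - M')
    rw [map_sub (HdDiv.divDiv Ω), hdiv, sub_self, inner_zero_right] at h1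
    have h2 := hC (C.symm (HdDiv.tensor Ω (M - M')))
    rw [C.apply_symm_apply, real_inner_comm, h1] at h2
    have h3 : ‖C.symm (HdDiv.tensor Ω (M - M'))‖ ^ 2 = 0 :=
      le_antisymm (nonpos_of_mul_nonpos_right h2 hα) (sq_nonneg _)
    rw [sq_eq_zero_iff, norm_eq_zero, C.symm.map_eq_zero_iff, map_sub, sub_eq_zero] at h3
    exact HdDiv.ext_tensor h3
  refine ⟨?_, hM⟩
  obtain ⟨N, hN⟩ := exists_divDiv_eq hΩ (u - u')
  have h1 := hdiff N
  rw [hM, sub_self, map_zero, map_zero, inner_zero_left, hN] at h1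
  exact sub_eq_zero.1 (inner_self_eq_zero.1 h1.symm)

set_option maxHeartbeats 1000000 in
/-- An `H²` function `w` with trace `g` and `div Div (C ∇∇w) = f` yields a solution of the mixed
problem. -/
theorem isMixedSolution_of_hess {Ω : Opens Plane} {C : SymTensorL2 Ω ≃L[ℝ] SymTensorL2 Ω}
    {f : L2 Ω} {g : H32 Ω} {w : H2 Ω} {M : HdDiv Ω} (hg : trGgrad Ω w = g)
    (hM : HdDiv.tensor Ω M = C (H2.hess Ω w)) (hf : HdDiv.divDiv Ω M = f) :
    IsMixedSolution C f g (H2.fn Ω w) M where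
  constitutive N := by
    rw [bdryDual_eq N g w hg, trdDiv_apply, hM, C.symm_apply_apply,
      real_inner_comm (H2.hess Ω w), real_inner_comm (H2.fn Ω w)]
    ring
  equilibrium v := by rw [hf]

end

end KirchhoffLove

set_option maxHeartbeats 1000000 in
open KirchhoffLove in
theorem proposition6p1 (Ω : TopologicalSpace.Opens Plane)
    (hΩ : Bornology.IsBounded (Ω : Set Plane))
    (C : SymTensorL2 Ω ≃L[ℝ] SymTensorL2 Ω)
    (hC : ∃ α : ℝ, 0 < α ∧ ∀ N : SymTensorL2 Ω, α * ‖N‖ ^ 2 ≤ inner ℝ (C N) N) :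
    ∃ c : ℝ, 0 < c ∧ ∀ (f : L2 Ω) (g : H32 Ω),
      (∃! p : L2 Ω × HdDiv Ω, IsMixedSolution C f g p.1 p.2) ∧
      ∀ (u : L2 Ω) (M : HdDiv Ω), IsMixedSolution C f g u M →
        ∃ w : H2 Ω, H2.fn Ω w = u ∧ trGgrad Ω w = g ∧
          HdDiv.tensor Ω M = C (H2.hess Ω w) ∧
          ‖w‖ + ‖M‖ ≤ c * (‖f‖ + traceNorm g) := by
  obtain ⟨c, hc, hsolve⟩ := exists_clamped_plate hΩ (C : SymTensorL2 Ω →L[ℝ] SymTensorL2 Ω) hC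
  set A : ℝ := ‖(C : SymTensorL2 Ω →L[ℝ] SymTensorL2 Ω)‖ with hA
  have hA0 : 0 ≤ A := norm_nonneg _
  refine ⟨(1 + A) * c + 1, by positivity, fun f g => ?_⟩
  obtain ⟨z₀, hz₀⟩ : ∃ z₀ : H2 Ω, trGgrad Ω z₀ = g := g.2
  obtain ⟨w, M, hw, hM, hf, -⟩ := hsolve f z₀
  have hsol : IsMixedSolution C f g (H2.fn Ω w) M :=
    isMixedSolution_of_hess (hw.trans hz₀) hM hf
  refine ⟨⟨(H2.fn Ω w, M), hsol, fun p hp => ?_⟩, fun u M₁ h₁ => ?_⟩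
  · obtain ⟨h1, h2⟩ := hp.unique hΩ hC hsol
    exact Prod.ext h1 h2
  obtain ⟨rfl, rfl⟩ := h₁.unique hΩ hC hsol
  refine ⟨w, rfl, hw.trans hz₀, hM, ?_⟩
  -- By uniqueness the plate problem started from any other extension `z` of `g` returns the same
  -- `w`, so its bound holds with `‖z‖` for each of them, and passes to the infimum.
  have hbound : ∀ z : H2 Ω, trGgrad Ω z = g → ‖w‖ ≤ c * (‖f‖ + ‖z‖) := fun z hz => by
    obtain ⟨w', M', hw', hM', hf', hn⟩ := hsolve f z
    have := (hsol.unique hΩ hC (isMixedSolution_of_hess (hw'.trans hz) hM' hf')).1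
    rwa [H2.ext_fn this]
  have htrace : ‖w‖ ≤ c * (‖f‖ + traceNorm g) := by
    have h1 : ‖w‖ / c - ‖f‖ ≤ traceNorm g := by
      refine le_csInf ⟨_, z₀, hz₀, rfl⟩ ?_
      rintro _ ⟨z, hz, rfl⟩
      rw [sub_le_iff_le_add', div_le_iff₀' hc]
      exact hbound z hz
    rwa [sub_le_iff_le_add', div_le_iff₀' hc] at h1
  have hMn : ‖M₁‖ ≤ A * ‖w‖ + ‖f‖ := by
    have h1 := norm_HdDiv_le M₁
    have h2 : ‖C (H2.hess Ω w)‖ ≤ A * ‖w‖ :=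
      ((C : SymTensorL2 Ω →L[ℝ] SymTensorL2 Ω).le_opNorm _).trans
        (mul_le_mul_of_nonneg_left (norm_hess_le w) hA0)
    rw [hM, hf] at h1
    exact h1.trans (add_le_add_left h2 _)
  have htr0 : 0 ≤ traceNorm g := Real.sInf_nonneg (by rintro _ ⟨z, -, rfl⟩; exact norm_nonneg z)
  have hAw := mul_le_mul_of_nonneg_left htrace hA0
  linarith
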